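/- Let $(R,\mathfrak m)$ be a commutative Noetherian local ring, let $\mathfrak a$ be a proper ideal of $R$, let $M$ be an $R$-module (not necessarily finitely generated), and let $n\ge 0$ be an integer. Let $H^i_{\mathfrak a}(M)$ denote the $i$-th local cohomology module, i.e. the value at $M$ of the $i$-th right derived functor of the $\mathfrak a$-torsion functor $\Gamma_{\mathfrak a}(M)=\{x\in M : \mathfrak a^t x=0 \text{ for some } t\ge 0\}$, and suppose that $H^i_{\mathfrak a}(M)=0$ for all $i\neq n$. Let $\operatorname{id}$ denote injective dimension over $R$, with values in $\{-\infty\}\cup\mathbb N\cup\{\infty\}$ and with $\operatorname{id}0=-\infty$. (i) If $\operatorname{id}M<\infty$, then $\operatorname{id}H^n_{\mathfrak a}(M)<\infty$. (ii) If $M$ is finitely generated and $\operatorname{id}H^n_{\mathfrak a}(M)<\infty$, then $\operatorname{id}M<\infty$. Furthermore, if $M$ is non-zero and finitely generated, then $\operatorname{id}H^n_{\mathfrak a}(M)=\operatorname{id}M-n$ (where $\infty-n=\infty$). -/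

import Mathlib

open CategoryTheory

universe u

noncomputable section

/-- The `𝔞`-torsion submodule `Γ_𝔞(M) = ⋃ₜ (0 :_M 𝔞ᵗ)` of an `R`-module `M`. -/
def adicTorsion {R : Type u} [CommRing R] (𝔞 : Ideal R) (M : Type u) [AddCommGroup M]
    [Module R M] : Submodule R M where
  carrier := {x | ∃ t : ℕ, ∀ r ∈ 𝔞 ^ t, r • x = 0}
  zero_mem' := ⟨0, fun r _ => smul_zero r⟩
  add_mem' := by
    rintro x y ⟨s, hs⟩ ⟨t, ht⟩
    refine ⟨s + t, fun r hr => ?_⟩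
    rw [smul_add, hs r (Ideal.pow_le_pow_right (Nat.le_add_right s t) hr),
      ht r (Ideal.pow_le_pow_right (Nat.le_add_left t s) hr), add_zero]
  smul_mem' := by
    rintro c x ⟨t, ht⟩
    exact ⟨t, fun r hr => by rw [smul_comm, ht r hr, smul_zero]⟩

theorem map_mem_adicTorsion {R : Type u} [CommRing R] (𝔞 : Ideal R) {M N : Type u}
    [AddCommGroup M] [Module R M] [AddCommGroup N] [Module R N] (f : M →ₗ[R] N)
    (x : M) (hx : x ∈ adicTorsion 𝔞 M) : f x ∈ adicTorsion 𝔞 N := by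
  obtain ⟨t, ht⟩ := hx
  exact ⟨t, fun r hr => by rw [← map_smul, ht r hr, map_zero]⟩

/-- The `𝔞`-torsion functor `Γ_𝔞` on the category of `R`-modules; on morphisms it is restriction
to the torsion submodules. -/
def adicTorsionFunctor {R : Type u} [CommRing R] (𝔞 : Ideal R) :
    ModuleCat.{u} R ⥤ ModuleCat.{u} R where
  obj M := ModuleCat.of R (adicTorsion 𝔞 M)
  map f := ModuleCat.ofHom (f.hom.restrict (map_mem_adicTorsion 𝔞 f.hom))

instance adicTorsionFunctor_additive {R : Type u} [CommRing R] (𝔞 : Ideal R) :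
    (adicTorsionFunctor 𝔞).Additive where
  map_add := rfl

/-- The `i`-th local cohomology module `H^i_𝔞(M)`: the `i`-th right derived functor of the
`𝔞`-torsion functor `Γ_𝔞`, evaluated at `M`. -/
def localCohomologyModule {R : Type u} [CommRing R] (𝔞 : Ideal R) (i : ℕ) (M : Type u)
    [AddCommGroup M] [Module R M] : ModuleCat.{u} R :=
  ((adicTorsionFunctor 𝔞).rightDerived i).obj (ModuleCat.of R M)

/-- The injective dimension of an `R`-module, with values in `{-∞} ∪ ℕ ∪ {∞}`
(the zero module has injective dimension `⊥ = -∞`). -/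
def injDim (R : Type u) [CommRing R] (M : Type u) [AddCommGroup M] [Module R M] : WithBot ℕ∞ :=
  injectiveDimension (ModuleCat.of R M)

end

/-! Let I be an injective resolution of M and T = Γ_𝔞(I). By Artin–Rees, Γ_𝔞 preserves injectives,
so T is a complex of injectives, exact except in degree n. Below n it splits, so its boundaries
B^n(T) are injective; from n on it resolves the cocycles Z^n(T), which are an extension of H^n_𝔞(M)
by B^n(T). Thus bounds id ≤ m pass between H^n_𝔞(M) and Z^n(T).

If id M ≤ n + m, then Z^{n+m}(I) is injective, hence so is Γ_𝔞(Z^{n+m}(I)) = Z^{n+m}(T), and id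
Z^n(T) ≤ m. No finiteness is needed here.

Conversely, let k be the residue field. Maps from k into I land in T because 𝔞 ⊆ 𝔪, so vanishing of
Ext^{i+1}(k, Z^n(T)) forces vanishing of Ext^{n+i+1}(k, M). For finitely generated M, Nakayama and
prime filtrations show that k detects injective dimension. The same argument shows H^n_𝔞(M) ≠ 0 when
M ≠ 0; together with the vanishing of H^j_𝔞(M) for j > id M, this gives the equality. -/

open Abelian

namespace ModuleCat

/-! ### Testing injective dimension against the residue field -/

section ResidueField

variable {R : Type u} [CommRing R]

/-- Injective dimension `< t` can be tested against finitely generated modules. -/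
theorem hasInjectiveDimensionLT_of_forall_finite (M : ModuleCat.{u} R) (t : ℕ)
    (h : ∀ N : ModuleCat.{u} R, Module.Finite R N → Subsingleton (Ext N M t)) :
    HasInjectiveDimensionLT M t := by
  induction t generalizing M with
  | zero =>
    rw [hasInjectiveDimensionLT_zero_iff_isZero, ModuleCat.isZero_iff_subsingleton]
    have h1 := h (ModuleCat.of R R) inferInstance
    have h2 : Subsingleton (ModuleCat.of R R ⟶ M) := Ext.homEquiv₀.subsingleton_congr.mp h1
    refine subsingleton_of_forall_eq 0 fun x => ?_
    have h3 := h2.elim (ModuleCat.ofHom (LinearMap.toSpanSingleton R M x)) 0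
    simpa using congr($(h3).hom (1 : R))
  | succ t ih =>
    cases t with
    | zero =>
      rw [zero_add, ← injective_iff_hasInjectiveDimensionLT_one]
      refine @Module.injective_object_of_injective_module R _ _ _ _
        (Module.Baer.injective ?_)
      intro I g
      have hS : (ModuleCat.shortComplexOfCompEqZero I.subtype I.mkQ
          (LinearMap.exact_subtype_mkQ I).linearMap_comp_eq_zero).ShortExact :=
        ModuleCat.shortComplex_shortExact _ (LinearMap.exact_subtype_mkQ I)
          (Submodule.injective_subtype I) (Submodule.mkQ_surjective I)
      have := h (ModuleCat.of R (R ⧸ I)) inferInstance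
      obtain ⟨x, hx⟩ := Ext.contravariant_sequence_exact₁ hS M
        (Ext.mk₀ (ModuleCat.ofHom g)) (add_zero 1)
        (Subsingleton.elim (α := Ext (ModuleCat.of R (R ⧸ I)) M 1) _ _)
      obtain ⟨φ, rfl⟩ := Ext.homEquiv₀.symm.surjective x
      have hx' : (ModuleCat.ofHom I.subtype) ≫ φ = ModuleCat.ofHom g :=
        Ext.homEquiv₀.symm.injective (by simpa using! hx)
      exact ⟨φ.hom, fun y hy => congr($(hx').hom ⟨y, hy⟩)⟩
    | succ t =>
      let ⟨E, _, f, _⟩ := EnoughInjectives.presentation M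
      have hS : (ShortComplex.mk f _ (Limits.cokernel.condition f)).ShortExact :=
        { exact := ShortComplex.exact_cokernel f }
      refine hS.hasInjectiveDimensionLT_X₁ (t + 1) (ih _ fun N hN => ?_) inferInstance
      have := h N hN
      refine subsingleton_of_forall_eq 0 fun x => ?_
      obtain ⟨y, rfl⟩ := Ext.covariant_sequence_exact₃ N hS x rfl
        (Subsingleton.elim (α := Ext N M (t + 2)) _ _)
      rw [y.eq_zero_of_injective, Ext.zero_comp]

theorem subsingleton_ext_of_shortExact {S : ShortComplex (ModuleCat.{u} R)} (hS : S.ShortExact)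
    {M : ModuleCat.{u} R} {i : ℕ} (h₁ : Subsingleton (Ext S.X₁ M i))
    (h₃ : Subsingleton (Ext S.X₃ M i)) : Subsingleton (Ext S.X₂ M i) := by
  refine subsingleton_of_forall_eq 0 fun x => ?_
  obtain ⟨y, rfl⟩ := Ext.contravariant_sequence_exact₂ hS M x (Subsingleton.elim _ _)
  rw [Subsingleton.elim y 0, Ext.comp_zero]

theorem subsingleton_ext_of_linearEquiv {N N' M : ModuleCat.{u} R} (e : N ≃ₗ[R] N') {i : ℕ}
    (h : Subsingleton (Ext N' M i)) : Subsingleton (Ext N M i) := by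
  refine subsingleton_of_forall_eq 0 fun x => ?_
  have h1 : (Ext.mk₀ e.toModuleIso.hom).comp
      ((Ext.mk₀ e.toModuleIso.inv).comp x (zero_add i)) (zero_add i) = x := by
    rw [Ext.mk₀_comp_mk₀_assoc, Iso.hom_inv_id, Ext.mk₀_id_comp]
  rw [← h1, Subsingleton.elim ((Ext.mk₀ e.toModuleIso.inv).comp x (zero_add i)) 0, Ext.comp_zero]

variable [IsNoetherianRing R] [IsLocalRing R]

/-- If multiplication by an element of the maximal ideal is injective on `N`, then
`Ext N M i` vanishes as soon as `Ext (N ⧸ x N) M (i + 1)` does. -/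
theorem subsingleton_ext_of_quotSMulTop {M N : ModuleCat.{u} R} [Module.Finite R M]
    [Module.Finite R N] {x : R} (hx : x ∈ IsLocalRing.maximalIdeal R) (hreg : IsSMulRegular N x)
    {i : ℕ} (h : Subsingleton (Ext (ModuleCat.of R (QuotSMulTop x N)) M (i + 1))) :
    Subsingleton (Ext N M i) := by
  have hS : (N.smulShortComplex x).ShortExact := hreg.smulShortComplex_shortExact
  -- Nakayama: multiplication by x is onto the finitely generated module Ext N M i, because the next
  -- term of the long exact sequence vanishes.
  have hle : (⊤ : Submodule R (Ext N M i)) ≤ IsLocalRing.maximalIdeal R • ⊤ := by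
    intro e _
    obtain ⟨y, hy⟩ := Ext.contravariant_sequence_exact₁ hS M (n₀ := i) e (add_comm 1 i)
      (Subsingleton.elim (α := Ext (ModuleCat.of R (QuotSMulTop x N)) M (i + 1)) _ _)
    have key (y : Ext N M i) : x • y = (Ext.mk₀ (x • 𝟙 N)).comp y (zero_add i) := by
      rw [Ext.mk₀_smul, Ext.smul_comp, Ext.mk₀_id_comp]
    rw [← (key y).trans hy]
    exact Submodule.smul_mem_smul hx trivial
  have := Submodule.eq_bot_of_le_smul_of_le_jacobson_bot _ _ (Module.Finite.fg_top) hle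
    (IsLocalRing.maximalIdeal_le_jacobson _)
  exact (Submodule.subsingleton_iff R).1 (subsingleton_of_bot_eq_top this.symm)

/-- Over a Noetherian local ring, the vanishing of `Ext k M i` for all `i ≥ t`, where `k` is the
residue field and `M` is finitely generated, implies the vanishing of `Ext N M i` for all `i ≥ t`
and all finitely generated `N`. -/
theorem subsingleton_ext_of_residueField (M : ModuleCat.{u} R) [Module.Finite R M] (t : ℕ)
    (h : ∀ i, t ≤ i →
      Subsingleton (Ext (ModuleCat.of R (R ⧸ IsLocalRing.maximalIdeal R)) M i))
    (J : Ideal R) (N : Type u) [AddCommGroup N] [Module R N] (hN : Module.Finite R N)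
    (hJ : ∀ r ∈ J, ∀ y : N, r • y = 0) (i : ℕ) (hi : t ≤ i) :
    Subsingleton (Ext (ModuleCat.of R N) M i) := by
  -- Noetherian induction on an ideal killing N, larger ideals first; inside it, a prime filtration
  -- reduces to N ≅ R/q. The degree i must stay free because the regular-element step raises it by
  -- one.
  induction J using IsNoetherian.induction generalizing N i with
  | hgt J ih =>
  revert hJ i
  induction hN using IsNoetherianRing.induction_on_isQuotientEquivQuotientPrime R with
  | subsingleton N =>
    intro _ i _
    refine subsingleton_of_forall_eq 0 fun x => ?_
    rw [← Ext.mk₀_id_comp x,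
      (ModuleCat.isZero_of_subsingleton (ModuleCat.of R N)).eq_zero_of_src (𝟙 _),
      Ext.mk₀_zero, Ext.zero_comp]
  | quotient N q e =>
    intro hJ i hi
    have hann (r : R) : r ∈ q.1 ↔ ∀ y : N, r • y = 0 := by
      constructor
      · intro hr y
        obtain ⟨s, hs⟩ := Ideal.Quotient.mk_surjective (e y)
        apply e.injective
        rw [map_smul, map_zero, ← hs, ← Ideal.Quotient.mkₐ_eq_mk R, ← map_smul,
          Ideal.Quotient.mkₐ_eq_mk, Ideal.Quotient.eq_zero_iff_mem]
        exact q.1.mul_mem_right s hr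
      · intro hr
        have := congr(e $(hr (e.symm 1)))
        rwa [map_smul, map_zero, e.apply_symm_apply, Algebra.smul_def, mul_one,
          Ideal.Quotient.algebraMap_eq, Ideal.Quotient.eq_zero_iff_mem] at this
    have hJq : J ≤ q.1 := fun r hr => (hann r).2 (hJ r hr)
    rcases hJq.lt_or_eq with hlt | rfl
    · exact ih q.1 hlt N ‹_› (fun r hr => (hann r).1 hr) i hi
    by_cases hqm : q.1 = IsLocalRing.maximalIdeal R
    · refine subsingleton_ext_of_linearEquiv (N := ModuleCat.of R N)
        (N' := ModuleCat.of R (R ⧸ IsLocalRing.maximalIdeal R)) ?_ (h i hi)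
      exact e.trans (Submodule.quotEquivOfEq _ _ hqm)
    -- Such an x in 𝔪 but not in q is regular on N ≅ R/q, and N/xN is killed by the strictly larger
    -- ideal q + (x).
    obtain ⟨x, hxm, hxq⟩ := SetLike.exists_of_lt
      ((IsLocalRing.le_maximalIdeal q.2.ne_top).lt_of_ne hqm)
    have : Module.Finite R (ModuleCat.of R N) := ‹_›
    refine subsingleton_ext_of_quotSMulTop (N := ModuleCat.of R N) hxm ?_ ?_
    · refine (isSMulRegular_iff_right_eq_zero_of_smul (M := N) (r := x)).2 fun y hy => ?_
      obtain ⟨s, hs⟩ := Ideal.Quotient.mk_surjective (e y)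
      apply e.injective
      have := congr(e $hy)
      rw [map_smul, map_zero, ← hs, ← Ideal.Quotient.mkₐ_eq_mk R, ← map_smul,
          Ideal.Quotient.mkₐ_eq_mk, Ideal.Quotient.eq_zero_iff_mem] at this
      rw [map_zero, ← hs, Ideal.Quotient.eq_zero_iff_mem]
      exact (q.2.mem_or_mem this).resolve_left hxq
    · refine ih (q.1 ⊔ Ideal.span {x}) ?_ _ inferInstance ?_ (i + 1) (by lia)
      · refine lt_of_le_of_ne le_sup_left fun heq => hxq ?_
        rw [heq]
        exact Ideal.mem_sup_right (Ideal.mem_span_singleton_self x)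
      · suffices q.1 ⊔ Ideal.span {x} ≤ Module.annihilator R (QuotSMulTop x N) from
          fun r hr => Module.mem_annihilator.1 (this hr)
        refine sup_le (fun r hr => ?_) ?_
        · refine Module.mem_annihilator.2 fun y => ?_
          obtain ⟨z, rfl⟩ := Submodule.mkQ_surjective _ y
          rw [← LinearMap.map_smul, (hann r).1 hr z, LinearMap.map_zero]
        · rw [Ideal.span_singleton_le_iff_mem]
          exact QuotSMulTop.mem_annihilator N x
  | exact N₁ N₂ N₃ f g hf hg hfg h₁ h₃ =>
    intro hJ i hi
    have hS : (ModuleCat.shortComplexOfCompEqZero f g hfg.linearMap_comp_eq_zero).ShortExact :=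
      ModuleCat.shortComplex_shortExact _ hfg hf hg
    refine subsingleton_ext_of_shortExact hS (h₁ (fun r hr y => ?_) i hi)
      (h₃ (fun r hr y => ?_) i hi)
    · apply hf
      rw [map_smul, map_zero, hJ r hr]
    · obtain ⟨z, rfl⟩ := hg y
      rw [← map_smul, hJ r hr, map_zero]

/-- The injective dimension of a finitely generated module over a Noetherian local ring can be
tested against the residue field. -/
theorem hasInjectiveDimensionLT_of_residueField (M : ModuleCat.{u} R) [Module.Finite R M] (t : ℕ)
    (h : ∀ i, t ≤ i →
      Subsingleton (Ext (ModuleCat.of R (R ⧸ IsLocalRing.maximalIdeal R)) M i)) :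
    HasInjectiveDimensionLT M t :=
  hasInjectiveDimensionLT_of_forall_finite M t fun N hN =>
    subsingleton_ext_of_residueField M t h ⊥ N hN
      (fun r hr y => by rw [(Submodule.mem_bot R).1 hr, zero_smul]) t le_rfl

end ResidueField

end ModuleCat

/-! ### Γ_𝔞 preserves injectives -/

section Torsion

variable {R : Type u} [CommRing R]

/-- Baer's criterion with Artin–Rees: if 𝔞^t kills the image of g, then I ∩ 𝔞^(k+t) ⊆ 𝔞^t I lies in
its kernel. So g factors through the image of I in R/𝔞^(k+t), and any extension of that map to
R/𝔞^(k+t) → E has torsion values. -/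
theorem injective_adicTorsion [IsNoetherianRing R] (𝔞 : Ideal R) (E : Type u)
    [AddCommGroup E] [Module R E] [Module.Injective R E] :
    Module.Injective R (adicTorsion 𝔞 E) := by
  refine Module.Baer.injective fun I g => ?_
  -- a power of `𝔞` kills the image of `g`
  have hpow : ∃ t : ℕ, ∀ r ∈ 𝔞 ^ t, ∀ y : I, r • g y = 0 := by
    suffices ∀ S : Submodule R I, S.FG → ∃ t : ℕ, ∀ r ∈ 𝔞 ^ t, ∀ y ∈ S, r • g y = 0 by
      obtain ⟨t, ht⟩ := this ⊤ (IsNoetherian.noetherian _)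
      exact ⟨t, fun r hr y => ht r hr y trivial⟩
    intro S hS
    refine Submodule.fg_induction
      (motive := fun S _ => ∃ t : ℕ, ∀ r ∈ 𝔞 ^ t, ∀ y ∈ S, r • g y = 0) (fun x => ?_) ?_ S hS
    · obtain ⟨t, ht⟩ := (g x).2
      refine ⟨t, fun r hr y hy => ?_⟩
      obtain ⟨c, rfl⟩ := Submodule.mem_span_singleton.1 hy
      rw [map_smul, smul_comm, show r • g x = 0 from Subtype.ext (ht r hr), smul_zero]
    · rintro S₁ S₂ - - ⟨t₁, ht₁⟩ ⟨t₂, ht₂⟩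
      refine ⟨t₁ + t₂, fun r hr y hy => ?_⟩
      obtain ⟨y₁, hy₁, y₂, hy₂, rfl⟩ := Submodule.mem_sup.1 hy
      rw [map_add, smul_add, ht₁ r (Ideal.pow_le_pow_right (Nat.le_add_right _ _) hr) y₁ hy₁,
        ht₂ r (Ideal.pow_le_pow_right (Nat.le_add_left _ _) hr) y₂ hy₂, add_zero]
  obtain ⟨t, ht⟩ := hpow
  obtain ⟨k, hk⟩ := 𝔞.exists_pow_inf_eq_pow_smul (I : Submodule R R)
  let f : I →ₗ[R] (R ⧸ 𝔞 ^ (k + t)) := (𝔞 ^ (k + t)).mkQ ∘ₗ I.subtype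
  let g' : I →ₗ[R] E := (adicTorsion 𝔞 E).subtype ∘ₗ g
  have hker : LinearMap.ker f ≤ LinearMap.ker g' := by
    intro y hy
    have hy1 : (y : R) ∈ 𝔞 ^ (k + t) := by
      simpa [f, Ideal.Quotient.eq_zero_iff_mem] using! hy
    have hy2 : (y : R) ∈ 𝔞 ^ t • I := by
      have h1 : (y : R) ∈ 𝔞 ^ (k + t) • (⊤ : Submodule R R) ⊓ I :=
        ⟨by simpa using hy1, y.2⟩
      rw [hk (k + t) (Nat.le_add_right _ _), Nat.add_sub_cancel_left] at h1
      exact Submodule.smul_mono le_rfl inf_le_right h1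
    have key : 𝔞 ^ t • I ≤ (LinearMap.ker g').map I.subtype := by
      refine Submodule.smul_le.2 fun r hr z hz => ⟨r • ⟨z, hz⟩, ?_, rfl⟩
      rw [SetLike.mem_coe, LinearMap.mem_ker]
      change ((g (r • ⟨z, hz⟩) : adicTorsion 𝔞 E) : E) = 0
      rw [map_smul, ht r hr, ZeroMemClass.coe_zero]
    obtain ⟨z, hz, hzy⟩ := key hy2
    rwa [← Subtype.ext (a1 := z) (a2 := y) hzy]
  obtain ⟨h, hh⟩ := Module.Injective.extension_property R _ _ _
    ((LinearMap.ker f).liftQ f le_rfl)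
    (LinearMap.ker_eq_bot.1 (Submodule.ker_liftQ_eq_bot _ _ _ le_rfl))
    ((LinearMap.ker f).liftQ g' hker)
  have hh' (y : I) : h (f y) = g' y := congr($hh (Submodule.Quotient.mk y))
  let e : R →ₗ[R] E := h ∘ₗ (𝔞 ^ (k + t)).mkQ
  have he (r : R) : e r ∈ adicTorsion 𝔞 E := by
    refine ⟨k + t, fun s hs => ?_⟩
    have : (𝔞 ^ (k + t)).mkQ (s • r) = 0 := by
      simpa using! Ideal.Quotient.eq_zero_iff_mem.2 ((𝔞 ^ (k + t)).mul_mem_right r hs)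
    rw [← map_smul, LinearMap.comp_apply, this, map_zero]
  exact ⟨e.codRestrict _ he, fun y hy => Subtype.ext (hh' ⟨y, hy⟩)⟩

end Torsion

/-! ### Dimension shifting along an injective middle term -/

namespace CategoryTheory.ShortComplex.ShortExact

variable {R : Type u} [CommRing R] {S : ShortComplex (ModuleCat.{u} R)} (hS : S.ShortExact)
  (hI : Injective S.X₂)

include hS hI

theorem subsingleton_ext_iff (k : ModuleCat.{u} R) (i : ℕ) :
    Subsingleton (Ext k S.X₁ (i + 2)) ↔ Subsingleton (Ext k S.X₃ (i + 1)) := by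
  constructor
  · intro h1
    refine subsingleton_of_forall_eq 0 fun x => ?_
    obtain ⟨y, rfl⟩ := Ext.covariant_sequence_exact₃ k hS x rfl (h1.elim _ _)
    rw [y.eq_zero_of_injective, Ext.zero_comp]
  · intro h1
    refine subsingleton_of_forall_eq 0 fun x => ?_
    obtain ⟨y, rfl⟩ := Ext.covariant_sequence_exact₁ k hS x (Ext.eq_zero_of_injective _) rfl
    rw [h1.elim y 0, Ext.zero_comp]

theorem subsingleton_ext_one_iff (k : ModuleCat.{u} R) :
    Subsingleton (Ext k S.X₁ 1) ↔ ∀ φ : k ⟶ S.X₃, ∃ ψ : k ⟶ S.X₂, ψ ≫ S.g = φ := by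
  constructor
  · intro h1 φ
    obtain ⟨y, hy⟩ := Ext.covariant_sequence_exact₃ k hS (Ext.mk₀ φ) (zero_add 1) (h1.elim _ _)
    obtain ⟨ψ, rfl⟩ := Ext.homEquiv₀.symm.surjective y
    exact ⟨ψ, Ext.homEquiv₀.symm.injective (by simpa using hy)⟩
  · intro h1
    refine subsingleton_of_forall_eq 0 fun x => ?_
    obtain ⟨y, rfl⟩ := Ext.covariant_sequence_exact₁ k hS x (Ext.eq_zero_of_injective _)
      (zero_add 1)
    obtain ⟨φ, rfl⟩ := Ext.homEquiv₀.symm.surjective y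
    obtain ⟨ψ, rfl⟩ := h1 φ
    rw [Ext.homEquiv₀_symm_apply, ← Ext.mk₀_comp_mk₀, Ext.comp_assoc_of_second_deg_zero,
      hS.comp_extClass, Ext.comp_zero]

end CategoryTheory.ShortComplex.ShortExact

section LinearMap

variable {R : Type u} [CommRing R] {X Y : Type u} [AddCommGroup X] [Module R X] [AddCommGroup Y]
  [Module R Y] (d : X →ₗ[R] Y)

/-- The short complex `0 → ker d → X → B → 0` for a submodule `B` containing the range of `d`. -/
def LinearMap.kerShortComplex (B : Submodule R Y) (h : LinearMap.range d ≤ B) :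
    ShortComplex (ModuleCat.{u} R) :=
  ModuleCat.shortComplexOfCompEqZero (LinearMap.ker d).subtype
    (d.codRestrict B fun x => h ⟨x, rfl⟩) (by ext x; exact x.2)

theorem LinearMap.shortExact_kerShortComplex (B : Submodule R Y) (h : LinearMap.range d = B) :
    (d.kerShortComplex B h.le).ShortExact := by
  refine ModuleCat.shortComplex_shortExact _ ?_ (Submodule.injective_subtype _) ?_
  · intro x
    constructor
    · intro hx
      exact ⟨⟨x, congr_arg Subtype.val hx⟩, rfl⟩
    · rintro ⟨y, rfl⟩
      exact Subtype.ext y.2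
  · rintro ⟨y, hy⟩
    obtain ⟨x, rfl⟩ := h.ge hy
    exact ⟨x, rfl⟩

theorem subsingleton_ext_ker_iff [Module.Injective R X] (B : Submodule R Y)
    (h : LinearMap.range d = B) (k : ModuleCat.{u} R) (i : ℕ) :
    Subsingleton (Ext k (ModuleCat.of R (LinearMap.ker d)) (i + 2)) ↔
      Subsingleton (Ext k (ModuleCat.of R B) (i + 1)) :=
  (d.shortExact_kerShortComplex B h).subsingleton_ext_iff
    (Module.injective_object_of_injective_module R X) k i

theorem hasInjectiveDimensionLT_ker_iff [Module.Injective R X] (B : Submodule R Y)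
    (h : LinearMap.range d = B) (i : ℕ) :
    HasInjectiveDimensionLT (ModuleCat.of R (LinearMap.ker d)) (i + 2) ↔
      HasInjectiveDimensionLT (ModuleCat.of R B) (i + 1) :=
  ((d.shortExact_kerShortComplex B h).hasInjectiveDimensionLT_X₃_iff i
    (Module.injective_object_of_injective_module R X)).symm

/-- Phrasing Ext¹ as an elementwise lifting problem allows maps to be moved between I and Γ_𝔞(I). -/
theorem subsingleton_ext_one_ker_iff [Module.Injective R X] (k : ModuleCat.{u} R) :
    Subsingleton (Ext k (ModuleCat.of R (LinearMap.ker d)) 1) ↔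
      ∀ f : k →ₗ[R] Y, (∀ x, f x ∈ LinearMap.range d) → ∃ g : k →ₗ[R] X, ∀ x, d (g x) = f x := by
  refine ((d.shortExact_kerShortComplex _ rfl).subsingleton_ext_one_iff
    (Module.injective_object_of_injective_module R X) k).trans ⟨fun h f hf => ?_, fun h φ => ?_⟩
  · obtain ⟨ψ, hψ⟩ := h (ModuleCat.ofHom (f.codRestrict _ hf))
    exact ⟨ψ.hom, fun x => congr_arg Subtype.val congr($(hψ).hom x)⟩
  · obtain ⟨g, hg⟩ := h ((LinearMap.range d).subtype ∘ₗ φ.hom) fun x => (φ.hom x).2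
    exact ⟨ModuleCat.ofHom g, ModuleCat.hom_ext (LinearMap.ext fun x => Subtype.ext (hg x))⟩

end LinearMap

/-! ### Complexes of injectives exact on one side of degree n -/

section Complex

variable {R : Type u} [CommRing R] (K : CochainComplex (ModuleCat.{u} R) ℕ)

theorem CochainComplex.range_le_ker (j : ℕ) :
    LinearMap.range (K.d (j - 1) j).hom ≤ LinearMap.ker (K.d j (j + 1)).hom := by
  rintro _ ⟨x, rfl⟩
  exact congr($(K.d_comp_d (j - 1) j (j + 1)).hom x)

/-- The cohomology of a cochain complex of modules as a quotient of the cocycles. -/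
theorem CochainComplex.exists_ker_to_homology (j : ℕ) {H : ModuleCat.{u} R}
    (e : K.homology j ≅ H) :
    ∃ π : LinearMap.ker (K.d j (j + 1)).hom →ₗ[R] H, Function.Surjective π ∧
      ∀ z, π z = 0 ↔ (z : K.X j) ∈ LinearMap.range (K.d (j - 1) j).hom := by
  have hprev : (ComplexShape.up ℕ).prev j = j - 1 := by
    cases j
    · simp
    · simp
  let S := K.sc' (j - 1) j (j + 1)
  let e' : S.moduleCatLeftHomologyData.H ≅ H :=
    S.moduleCatHomologyIso.symm ≪≫ (K.homologyIsoSc' (j - 1) j (j + 1) hprev (by simp)).symm ≪≫ e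
  let q := S.moduleCatLeftHomologyData.π.hom
  refine ⟨e'.toLinearEquiv.toLinearMap ∘ₗ q,
    e'.toLinearEquiv.surjective.comp (Submodule.mkQ_surjective _), fun z => ?_⟩
  have h1 : e'.toLinearEquiv (q z) = 0 ↔ q z = 0 := e'.toLinearEquiv.map_eq_zero_iff
  refine h1.trans ((Submodule.Quotient.mk_eq_zero _).trans ⟨?_, ?_⟩)
  · rintro ⟨x, rfl⟩
    exact ⟨x, rfl⟩
  · rintro ⟨x, hx⟩
    exact ⟨x, Subtype.ext hx⟩

variable (hK : ∀ j, Module.Injective R (K.X j)) {n : ℕ}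

include hK

/-- Each image is the quotient of an injective by the preceding cocycles, which by exactness are the
preceding, already injective, image. -/
theorem CochainComplex.injective_range
    (hex : ∀ j < n, LinearMap.range (K.d (j - 1) j).hom = LinearMap.ker (K.d j (j + 1)).hom)
    (j : ℕ) (hj : j ≤ n) :
    HasInjectiveDimensionLT (ModuleCat.of R (LinearMap.range (K.d (j - 1) j).hom)) 1 := by
  induction j with
  | zero =>
    -- Truncated subtraction makes this the map from degree 0 to itself, which is zero, so the
    -- boundaries in degree 0 vanish as they should.
    have h0 : K.d (0 - 1) 0 = 0 := K.shape _ _ (by simp)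
    have : Subsingleton (LinearMap.range (K.d (0 - 1) 0).hom) := by
      rw [h0, ModuleCat.hom_zero, LinearMap.range_zero]
      infer_instance
    have := (ModuleCat.isZero_of_subsingleton
      (ModuleCat.of R (LinearMap.range (K.d (0 - 1) 0).hom))).hasInjectiveDimensionLT_zero
    exact hasInjectiveDimensionLT_of_ge _ 0 1 zero_le_one
  | succ j ih =>
    have h1 := ih (by lia)
    rw [hex j (by lia)] at h1
    have := hK j
    exact (hasInjectiveDimensionLT_ker_iff (K.d j (j + 1)).hom _ rfl 0).1
      (hasInjectiveDimensionLT_of_ge _ 1 2 one_le_two)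

variable
    (hex : ∀ j, n ≤ j →
      LinearMap.range (K.d j (j + 1)).hom = LinearMap.ker (K.d (j + 1) (j + 1 + 1)).hom)

include hex

theorem CochainComplex.hasInjectiveDimensionLT_ker_iff (m l : ℕ) (hl : l = n + m) :
    HasInjectiveDimensionLT (ModuleCat.of R (LinearMap.ker (K.d n (n + 1)).hom)) (m + 1) ↔
      HasInjectiveDimensionLT (ModuleCat.of R (LinearMap.ker (K.d l (l + 1)).hom)) 1 := by
  induction m generalizing n with
  | zero => rw [hl]; rfl
  | succ m ih =>
    have := hK n
    rw [_root_.hasInjectiveDimensionLT_ker_iff _ _ (hex n le_rfl) m,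
      ih (fun j hj => hex j (by lia)) (by lia)]

theorem CochainComplex.subsingleton_ext_ker_iff (k : ModuleCat.{u} R) (m l : ℕ) (hl : l = n + m) :
    Subsingleton (Ext k (ModuleCat.of R (LinearMap.ker (K.d n (n + 1)).hom)) (m + 1)) ↔
      Subsingleton (Ext k (ModuleCat.of R (LinearMap.ker (K.d l (l + 1)).hom)) 1) := by
  induction m generalizing n with
  | zero => rw [hl]; rfl
  | succ m ih =>
    have := hK n
    rw [_root_.subsingleton_ext_ker_iff _ _ (hex n le_rfl) k m,
      ih (fun j hj => hex j (by lia)) (by lia)]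

end Complex

/-! ### The complex Γ_𝔞(K) inside K -/

section TorsionComplex

variable {R : Type u} [CommRing R] (𝔞 : Ideal R) (K : CochainComplex (ModuleCat.{u} R) ℕ)

/-- The complex `Γ_𝔞(K)`. -/
noncomputable abbrev torsionComplex : CochainComplex (ModuleCat.{u} R) ℕ :=
  ((adicTorsionFunctor 𝔞).mapHomologicalComplex _).obj K

/-- The inclusion `Γ_𝔞(K) → K` in degree `j`. -/
def torsionComplexInclusion (j : ℕ) : (torsionComplex 𝔞 K).X j →ₗ[R] K.X j :=
  (adicTorsion 𝔞 (K.X j)).subtype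

theorem torsionComplexInclusion_injective (j : ℕ) :
    Function.Injective (torsionComplexInclusion 𝔞 K j) :=
  Submodule.injective_subtype _

theorem torsionComplexInclusion_d (i j : ℕ) (x : (torsionComplex 𝔞 K).X i) :
    torsionComplexInclusion 𝔞 K j (((torsionComplex 𝔞 K).d i j).hom x) =
      (K.d i j).hom (torsionComplexInclusion 𝔞 K i x) :=
  rfl

theorem range_torsionComplexInclusion (j : ℕ) :
    LinearMap.range (torsionComplexInclusion 𝔞 K j) = adicTorsion 𝔞 (K.X j) :=
  Submodule.range_subtype _

theorem mem_ker_torsionComplex_d (i j : ℕ) (x : (torsionComplex 𝔞 K).X i) :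
    x ∈ LinearMap.ker ((torsionComplex 𝔞 K).d i j).hom ↔
      torsionComplexInclusion 𝔞 K i x ∈ LinearMap.ker (K.d i j).hom := by
  rw [LinearMap.mem_ker, LinearMap.mem_ker, ← torsionComplexInclusion_d,
    (map_eq_zero_iff _ (torsionComplexInclusion_injective 𝔞 K j))]

/-- `Γ_𝔞` commutes with kernels. -/
noncomputable def torsionComplexKerEquiv (i j : ℕ) :
    adicTorsion 𝔞 (LinearMap.ker (K.d i j).hom) ≃ₗ[R]
      LinearMap.ker ((torsionComplex 𝔞 K).d i j).hom := by
  let f : adicTorsion 𝔞 (LinearMap.ker (K.d i j).hom) →ₗ[R] (torsionComplex 𝔞 K).X i :=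
    (LinearMap.ker (K.d i j).hom).subtype.restrict (map_mem_adicTorsion 𝔞 _)
  refine LinearEquiv.ofBijective
    (f.codRestrict _ fun x => (mem_ker_torsionComplex_d 𝔞 K i j _).2 x.1.2) ⟨?_, ?_⟩
  · intro x y hxy
    exact Subtype.ext (Subtype.ext
      (congr_arg (torsionComplexInclusion 𝔞 K i) (congr_arg Subtype.val hxy)))
  · intro z
    have hz := (mem_ker_torsionComplex_d 𝔞 K i j _).1 z.2
    obtain ⟨t, ht⟩ : torsionComplexInclusion 𝔞 K i z.1 ∈ adicTorsion 𝔞 (K.X i) :=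
      (range_torsionComplexInclusion 𝔞 K i).le ⟨_, rfl⟩
    exact ⟨⟨⟨_, hz⟩, t, fun r hr => Subtype.ext (ht r hr)⟩, rfl⟩

theorem injective_torsionComplex [IsNoetherianRing R] (hK : ∀ j, Module.Injective R (K.X j))
    (j : ℕ) : Module.Injective R ((torsionComplex 𝔞 K).X j) :=
  have := hK j
  injective_adicTorsion 𝔞 (K.X j)

theorem injective_ker_torsionComplex_d [IsNoetherianRing R] (i j : ℕ)
    (h : Module.Injective R (LinearMap.ker (K.d i j).hom)) :
    Module.Injective R (LinearMap.ker ((torsionComplex 𝔞 K).d i j).hom) :=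
  have := injective_adicTorsion 𝔞 (LinearMap.ker (K.d i j).hom)
  Module.Injective.of_ringEquiv (RingEquiv.refl R) (torsionComplexKerEquiv 𝔞 K i j)

end TorsionComplex

theorem linearMap_quotient_mem_adicTorsion {R : Type u} [CommRing R] {𝔞 𝔪 : Ideal R} (h : 𝔞 ≤ 𝔪)
    {X : Type u} [AddCommGroup X] [Module R X] (f : (R ⧸ 𝔪) →ₗ[R] X) (x : R ⧸ 𝔪) :
    f x ∈ adicTorsion 𝔞 X := by
  refine map_mem_adicTorsion 𝔞 f x ⟨1, fun r hr => ?_⟩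
  rw [pow_one] at hr
  obtain ⟨y, rfl⟩ := Submodule.mkQ_surjective _ x
  rw [← map_smul]
  exact (Submodule.Quotient.mk_eq_zero _).2 (𝔪.mul_mem_right y (h hr))

/-! ### Comparing M with its local cohomology -/

section LocalCohomology

variable {R : Type u} [CommRing R] (𝔞 : Ideal R) {M : Type u} [AddCommGroup M] [Module R M]
  (I : InjectiveResolution (ModuleCat.of R M))

/-- A module is the module of zero-cocycles of its injective resolution. -/
noncomputable def CategoryTheory.InjectiveResolution.isoKer :
    ModuleCat.of R M ≅ ModuleCat.of R (LinearMap.ker (I.cocomplex.d 0 (0 + 1)).hom) :=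
  (HomologicalComplex.singleObjXSelf (ComplexShape.up ℕ) 0 (ModuleCat.of R M)).symm ≪≫
    Limits.IsLimit.conePointUniqueUpToIso I.isLimitKernelFork (ModuleCat.kernelIsLimit _)

theorem CategoryTheory.InjectiveResolution.range_eq_ker (j : ℕ) :
    LinearMap.range (I.cocomplex.d j (j + 1)).hom =
      LinearMap.ker (I.cocomplex.d (j + 1) (j + 1 + 1)).hom :=
  (I.exact_succ j).moduleCat_range_eq_ker

theorem CategoryTheory.InjectiveResolution.injective_X (j : ℕ) :
    Module.Injective R (I.cocomplex.X j) :=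
  have := I.injective j
  Module.injective_module_of_injective_object R (I.cocomplex.X j)

theorem exists_ker_to_localCohomologyModule (n : ℕ) :
    ∃ π : LinearMap.ker ((torsionComplex 𝔞 I.cocomplex).d n (n + 1)).hom →ₗ[R]
        localCohomologyModule 𝔞 n M, Function.Surjective π ∧
      ∀ z, π z = 0 ↔ (z : (torsionComplex 𝔞 I.cocomplex).X n) ∈
        LinearMap.range ((torsionComplex 𝔞 I.cocomplex).d (n - 1) n).hom :=
  CochainComplex.exists_ker_to_homology _ n (I.isoRightDerivedObj (adicTorsionFunctor 𝔞) n).symm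

theorem subsingleton_localCohomologyModule_iff (n : ℕ) :
    Subsingleton (localCohomologyModule 𝔞 n M) ↔
      LinearMap.range ((torsionComplex 𝔞 I.cocomplex).d (n - 1) n).hom =
        LinearMap.ker ((torsionComplex 𝔞 I.cocomplex).d n (n + 1)).hom := by
  obtain ⟨π, hπ, hker⟩ := exists_ker_to_localCohomologyModule 𝔞 I n
  constructor
  · intro h
    refine le_antisymm (CochainComplex.range_le_ker _ n) fun z hz => ?_
    exact (hker ⟨z, hz⟩).1 (Subsingleton.elim _ _)
  · intro h
    refine subsingleton_of_forall_eq 0 fun y => ?_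
    obtain ⟨z, rfl⟩ := hπ y
    exact (hker z).2 (h.ge z.2)

theorem exists_shortExact_localCohomologyModule (n : ℕ) :
    ∃ S : ShortComplex (ModuleCat.{u} R), S.ShortExact ∧
      Nonempty (S.X₁ ≅ ModuleCat.of R
        (LinearMap.range ((torsionComplex 𝔞 I.cocomplex).d (n - 1) n).hom)) ∧
      S.X₂ = ModuleCat.of R
        (LinearMap.ker ((torsionComplex 𝔞 I.cocomplex).d n (n + 1)).hom) ∧
      S.X₃ = localCohomologyModule 𝔞 n M := by
  obtain ⟨π, hπ, hker⟩ := exists_ker_to_localCohomologyModule 𝔞 I n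
  refine ⟨_, LinearMap.shortExact_shortComplexKer hπ, ⟨LinearEquiv.toModuleIso ?_⟩, rfl, rfl⟩
  have hle := CochainComplex.range_le_ker (torsionComplex 𝔞 I.cocomplex) n
  refine LinearEquiv.trans (LinearEquiv.ofEq _ _ ?_) (Submodule.submoduleOfEquivOfLe hle)
  ext z
  exact hker z

omit I in
theorem adicTorsion_eq_bot_of_subsingleton (h : Subsingleton (localCohomologyModule 𝔞 0 M)) :
    adicTorsion 𝔞 M = ⊥ := by
  let I := injectiveResolution (ModuleCat.of R M)
  have h1 := (subsingleton_localCohomologyModule_iff 𝔞 I 0).1 h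
  have h2 : (torsionComplex 𝔞 I.cocomplex).d (0 - 1) 0 = 0 :=
    HomologicalComplex.shape _ _ _ (by simp)
  rw [h2, ModuleCat.hom_zero, LinearMap.range_zero] at h1
  refine (Submodule.eq_bot_iff _).2 fun x hx => ?_
  have hx' := map_mem_adicTorsion 𝔞 I.isoKer.hom.hom x hx
  have h3 := (torsionComplexKerEquiv 𝔞 I.cocomplex 0 (0 + 1) ⟨_, hx'⟩).2
  have h4 := (LinearEquiv.map_eq_zero_iff _).1 (Subtype.ext ((Submodule.mem_bot R).1 (h1.ge h3)))
  exact I.isoKer.toLinearEquiv.map_eq_zero_iff.1 (congr_arg Subtype.val h4)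

variable (n : ℕ) (hn : ∀ i : ℕ, i ≠ n → Subsingleton (localCohomologyModule 𝔞 i M))

include hn

theorem range_torsionComplex_d_eq_ker (i : ℕ) (hi : i ≠ n) :
    LinearMap.range ((torsionComplex 𝔞 I.cocomplex).d (i - 1) i).hom =
      LinearMap.ker ((torsionComplex 𝔞 I.cocomplex).d i (i + 1)).hom :=
  (subsingleton_localCohomologyModule_iff 𝔞 I i).1 (hn i hi)

variable [IsNoetherianRing R]

theorem hasInjectiveDimensionLT_localCohomologyModule (m : ℕ)
    (h : HasInjectiveDimensionLT (ModuleCat.of R M) (n + m + 1)) :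
    HasInjectiveDimensionLT (localCohomologyModule 𝔞 n M) (m + 1) := by
  let I := injectiveResolution (ModuleCat.of R M)
  have hT := injective_torsionComplex 𝔞 I.cocomplex I.injective_X
  have h0 := hasInjectiveDimensionLT_of_iso I.isoKer (n + m + 1)
  rw [CochainComplex.hasInjectiveDimensionLT_ker_iff I.cocomplex I.injective_X
    (fun j _ => I.range_eq_ker j) (n + m) (n + m) (zero_add _).symm,
    ← injective_iff_hasInjectiveDimensionLT_one, ← Module.injective_iff_injective_object] at h0
  have h1 := injective_ker_torsionComplex_d 𝔞 I.cocomplex _ _ h0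
  rw [Module.injective_iff_injective_object, injective_iff_hasInjectiveDimensionLT_one,
    ← CochainComplex.hasInjectiveDimensionLT_ker_iff _ hT
      (fun j hj => range_torsionComplex_d_eq_ker 𝔞 I n hn (j + 1) (by lia)) m (n + m) rfl] at h1
  have h2 := CochainComplex.injective_range _ hT
    (fun j hj => range_torsionComplex_d_eq_ker 𝔞 I n hn j hj.ne) n le_rfl
  obtain ⟨S, hS, ⟨e⟩, e₂, e₃⟩ := exists_shortExact_localCohomologyModule 𝔞 I n
  rw [← e₂] at h1
  rw [← e₃]
  have := hasInjectiveDimensionLT_of_iso e.symm 1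
  exact hS.hasInjectiveDimensionLT_X₃ _ h1 (hasInjectiveDimensionLT_of_ge _ 1 _ (by lia))

omit hn [IsNoetherianRing R] in
-- Used to show n ≤ id M. Injectivity of Z^n(I) gives a retraction r of I^n onto it, and w - r(w)
-- corrects a preimage w of a torsion cocycle to a torsion one.
theorem subsingleton_localCohomologyModule_of_hasInjectiveDimensionLT
    (h : HasInjectiveDimensionLT (ModuleCat.of R M) (n + 1)) :
    Subsingleton (localCohomologyModule 𝔞 (n + 1) M) := by
  let I := injectiveResolution (ModuleCat.of R M)
  have h0 := hasInjectiveDimensionLT_of_iso I.isoKer (n + 1)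
  rw [CochainComplex.hasInjectiveDimensionLT_ker_iff I.cocomplex I.injective_X
    (fun j _ => I.range_eq_ker j) n n (zero_add _).symm,
    ← injective_iff_hasInjectiveDimensionLT_one, ← Module.injective_iff_injective_object] at h0
  rw [subsingleton_localCohomologyModule_iff 𝔞 I]
  refine le_antisymm (CochainComplex.range_le_ker _ (n + 1)) fun z hz => ?_
  have hz' := (mem_ker_torsionComplex_d 𝔞 I.cocomplex _ _ z).1 hz
  rw [← I.range_eq_ker n] at hz'
  obtain ⟨w, hw⟩ := hz'
  let d := (I.cocomplex.d n (n + 1)).hom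
  obtain ⟨r, hr⟩ := Module.Injective.extension_property R _ _ _ (LinearMap.ker d).subtype
    (Submodule.injective_subtype _) LinearMap.id
  obtain ⟨t, ht⟩ : torsionComplexInclusion 𝔞 I.cocomplex (n + 1) z ∈
      adicTorsion 𝔞 (I.cocomplex.X (n + 1)) :=
    (range_torsionComplexInclusion 𝔞 _ _).le ⟨_, rfl⟩
  -- If 𝔞^t kills d w, then a • w is a cocycle for a ∈ 𝔞^t, hence fixed by r.
  have hx : w - (r w : I.cocomplex.X n) ∈ adicTorsion 𝔞 (I.cocomplex.X n) := by
    refine ⟨t, fun a ha => ?_⟩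
    have hmem : a • w ∈ LinearMap.ker d := by
      rw [LinearMap.mem_ker, map_smul]
      exact (congr_arg (a • ·) hw).trans (ht a ha)
    have h1 : r (a • w) = ⟨a • w, hmem⟩ := congr($hr ⟨a • w, hmem⟩)
    rw [smul_sub, ← Submodule.coe_smul, ← map_smul, h1, sub_self]
  refine ⟨⟨w - (r w : I.cocomplex.X n), hx⟩, torsionComplexInclusion_injective 𝔞 _ _ ?_⟩
  have h2 : d (w - (r w : I.cocomplex.X n)) = d w := by
    rw [map_sub, show d (r w) = 0 from (r w).2, sub_zero]
  exact h2.trans hw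

/-- After shifting, both Ext groups measure lifting of maps from R/𝔪 through the differential in
degree n + i, of T and of I respectively. Such maps into I factor through T, so a lift in T is a
lift in I. -/
theorem subsingleton_ext_of_hasInjectiveDimensionLT_localCohomologyModule
    {𝔪 : Ideal R} (h𝔪 : 𝔞 ≤ 𝔪) (s : ℕ)
    (h : HasInjectiveDimensionLT (localCohomologyModule 𝔞 n M) (s + 1)) (i : ℕ) (hi : s ≤ i) :
    Subsingleton (Ext (ModuleCat.of R (R ⧸ 𝔪)) (ModuleCat.of R M) (n + i + 1)) := by
  let I := injectiveResolution (ModuleCat.of R M)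
  have hT := injective_torsionComplex 𝔞 I.cocomplex I.injective_X
  have h2 := CochainComplex.injective_range _ hT
    (fun j hj => range_torsionComplex_d_eq_ker 𝔞 I n hn j hj.ne) n le_rfl
  have h1 : HasInjectiveDimensionLT (ModuleCat.of R
      (LinearMap.ker ((torsionComplex 𝔞 I.cocomplex).d n (n + 1)).hom)) (s + 1) := by
    obtain ⟨S, hS, ⟨e⟩, e₂, e₃⟩ := exists_shortExact_localCohomologyModule 𝔞 I n
    rw [← e₂]
    rw [← e₃] at h
    have := hasInjectiveDimensionLT_of_iso e.symm 1
    exact hS.hasInjectiveDimensionLT_X₂ _ (hasInjectiveDimensionLT_of_ge _ 1 _ (by lia)) h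
  have hexT (j : ℕ) (hj : n ≤ j) := range_torsionComplex_d_eq_ker 𝔞 I n hn (j + 1) (by lia)
  have h3 := HasInjectiveDimensionLT.subsingleton _ _ (i + 1) (by lia : s + 1 ≤ i + 1)
    (ModuleCat.of R (R ⧸ 𝔪)) (hX := h1)
  have := hT (n + i)
  have := I.injective_X (n + i)
  rw [CochainComplex.subsingleton_ext_ker_iff _ hT hexT _ i (n + i) rfl,
    subsingleton_ext_one_ker_iff] at h3
  have h4 : Subsingleton (Ext (ModuleCat.of R (R ⧸ 𝔪)) (ModuleCat.of R
      (LinearMap.ker (I.cocomplex.d 0 (0 + 1)).hom)) (n + i + 1)) := by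
    rw [CochainComplex.subsingleton_ext_ker_iff _ I.injective_X (fun j _ => I.range_eq_ker j) _
      (n + i) (n + i) (zero_add _).symm, subsingleton_ext_one_ker_iff]
    intro f hf
    have hfT (x : R ⧸ 𝔪) : f x ∈ adicTorsion 𝔞 (I.cocomplex.X (n + i + 1)) :=
      linearMap_quotient_mem_adicTorsion h𝔪 f x
    let f' : (R ⧸ 𝔪) →ₗ[R] (torsionComplex 𝔞 I.cocomplex).X (n + i + 1) := f.codRestrict _ hfT
    obtain ⟨g, hg⟩ := h3 f' fun x => by
      refine (hexT (n + i) (by lia)).ge ((mem_ker_torsionComplex_d 𝔞 I.cocomplex _ _ _).2 ?_)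
      exact (I.range_eq_ker (n + i)).le (hf x)
    exact ⟨torsionComplexInclusion 𝔞 _ _ ∘ₗ g, fun x =>
      congr_arg (torsionComplexInclusion 𝔞 I.cocomplex _) (hg x)⟩
  refine subsingleton_of_forall_eq 0 fun x => ?_
  have h5 : (x.comp (Ext.mk₀ I.isoKer.hom) (add_zero _)).comp (Ext.mk₀ I.isoKer.inv)
      (add_zero _) = x := by
    simp
  rw [← h5, h4.elim (x.comp (Ext.mk₀ I.isoKer.hom) (add_zero _)) 0, Ext.zero_comp]

variable [IsLocalRing R] [Module.Finite R M]

theorem hasInjectiveDimensionLT_of_localCohomologyModule (h𝔞 : 𝔞 ≠ ⊤) (s : ℕ)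
    (h : HasInjectiveDimensionLT (localCohomologyModule 𝔞 n M) (s + 1)) :
    HasInjectiveDimensionLT (ModuleCat.of R M) (n + s + 1) := by
  refine ModuleCat.hasInjectiveDimensionLT_of_residueField _ _ fun i hi => ?_
  obtain ⟨j, rfl⟩ := Nat.exists_eq_add_of_le hi
  have := subsingleton_ext_of_hasInjectiveDimensionLT_localCohomologyModule 𝔞 n hn
    (IsLocalRing.le_maximalIdeal h𝔞) s h (s + j) (by lia)
  rwa [show n + s + 1 + j = n + (s + j) + 1 by lia]

/-- A nonzero finitely generated module over a Noetherian local ring has some nonvanishing local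
cohomology module. -/
theorem nontrivial_localCohomologyModule [Nontrivial M] (h𝔞 : 𝔞 ≠ ⊤) :
    Nontrivial (localCohomologyModule 𝔞 n M) := by
  by_contra hn'
  have hall (i : ℕ) : Subsingleton (localCohomologyModule 𝔞 i M) := by
    by_cases hi : i = n
    · exact hi ▸ not_nontrivial_iff_subsingleton.1 hn'
    · exact hn i hi
  have h0 : HasInjectiveDimensionLT (ModuleCat.of R M) 0 := by
    refine ModuleCat.hasInjectiveDimensionLT_of_residueField _ _ fun i _ => ?_
    cases i with
    | zero =>
      rw [Ext.homEquiv₀.subsingleton_congr]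
      refine subsingleton_of_forall_eq 0 fun φ => ModuleCat.hom_ext (LinearMap.ext fun x => ?_)
      have hT : adicTorsion 𝔞 M = ⊥ := adicTorsion_eq_bot_of_subsingleton 𝔞 (hall 0)
      have := linearMap_quotient_mem_adicTorsion (IsLocalRing.le_maximalIdeal h𝔞) φ.hom x
      exact (Submodule.mem_bot R).1 (hT.le this)
    | succ i =>
      have hz := (ModuleCat.isZero_of_subsingleton (M := localCohomologyModule 𝔞 0 M)
        ).hasInjectiveDimensionLT_zero
      -- As all local cohomology vanishes, degree 0 may play the role of n, with H^0 = 0; this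
      -- covers every positive Ext degree.
      have := subsingleton_ext_of_hasInjectiveDimensionLT_localCohomologyModule (M := M) 𝔞 0
        (fun i _ => hall i) (IsLocalRing.le_maximalIdeal h𝔞) 0
        (hasInjectiveDimensionLT_of_ge _ 0 1 zero_le_one) i (Nat.zero_le i)
      rwa [zero_add] at this
  rw [hasInjectiveDimensionLT_zero_iff_isZero, ModuleCat.isZero_iff_subsingleton] at h0
  exact not_subsingleton M h0

end LocalCohomology

theorem theorem2p5 {R : Type u} [CommRing R] [IsNoetherianRing R] [IsLocalRing R]
    (𝔞 : Ideal R) (h𝔞 : 𝔞 ≠ ⊤) (M : Type u) [AddCommGroup M] [Module R M] (n : ℕ)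
    (hn : ∀ i : ℕ, i ≠ n → Subsingleton (localCohomologyModule 𝔞 i M)) :
    (injDim R M < ⊤ → injDim R (localCohomologyModule 𝔞 n M) < ⊤) ∧
    (Module.Finite R M → injDim R (localCohomologyModule 𝔞 n M) < ⊤ → injDim R M < ⊤) ∧
    (Module.Finite R M → Nontrivial M →
      injDim R (localCohomologyModule 𝔞 n M) + (n : WithBot ℕ∞) = injDim R M) := by
  simp only [injDim, lt_top_iff_ne_top, injectiveDimension_ne_top_iff]
  refine ⟨fun ⟨d, hd⟩ => ⟨d, ?_⟩, fun _ ⟨s, hs⟩ => ⟨n + s, ?_⟩, fun _ _ => ?_⟩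
  · exact hasInjectiveDimensionLT_localCohomologyModule 𝔞 n hn d
      (hasInjectiveDimensionLT_of_ge _ (d + 1) _ (by lia))
  · exact hasInjectiveDimensionLT_of_localCohomologyModule 𝔞 n hn h𝔞 s hs
  change injectiveDimension (localCohomologyModule 𝔞 n M) + (n : WithBot ℕ∞) =
    injectiveDimension (ModuleCat.of R M)
  have hH := nontrivial_localCohomologyModule 𝔞 n hn h𝔞
  -- The two sides are compared through their upper bounds c.
  refine eq_of_forall_ge_iff fun c => ?_
  induction c with
  | bot =>
    have h1 : injectiveDimension (localCohomologyModule 𝔞 n M) ≠ ⊥ := by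
      rw [Ne, injectiveDimension_eq_bot_iff, ModuleCat.isZero_iff_subsingleton]
      exact not_subsingleton _
    have h2 : injectiveDimension (ModuleCat.of R M) ≠ ⊥ := by
      rw [Ne, injectiveDimension_eq_bot_iff, ModuleCat.isZero_iff_subsingleton]
      exact not_subsingleton M
    simp [le_bot_iff, WithBot.add_eq_bot, h1, h2]
  | coe c =>
    induction c with
    | top => simp
    | coe d =>
      change _ ≤ ((d : ℕ) : WithBot ℕ∞) ↔ _ ≤ ((d : ℕ) : WithBot ℕ∞)
      rw [injectiveDimension_le_iff]
      by_cases hnd : n ≤ d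
      · obtain ⟨m, rfl⟩ := Nat.exists_eq_add_of_le hnd
        rw [add_comm n m, Nat.cast_add, ENat.WithBot.add_le_add_natCast_right_iff,
          injectiveDimension_le_iff, add_comm m n]
        exact ⟨hasInjectiveDimensionLT_of_localCohomologyModule 𝔞 n hn h𝔞 m,
          hasInjectiveDimensionLT_localCohomologyModule 𝔞 n hn m⟩
      -- For d < n both bounds fail: id H^n ≥ 0 since H^n ≠ 0, and id M ≤ d would force H^n = 0.
      · refine iff_of_false (fun h => hnd ?_) fun h => ?_
        · have h0 : (0 : WithBot ℕ∞) ≤ injectiveDimension (localCohomologyModule 𝔞 n M) := by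
            have h3 := injectiveDimension_ge_iff (localCohomologyModule 𝔞 n M) 0
            rw [Nat.cast_zero] at h3
            rw [h3, hasInjectiveDimensionLT_zero_iff_isZero, ModuleCat.isZero_iff_subsingleton]
            exact not_subsingleton _
          have h4 : ((n : ℕ) : WithBot ℕ∞) ≤ ((d : ℕ) : WithBot ℕ∞) :=
            (le_add_of_nonneg_left h0).trans h
          exact_mod_cast h4
        · obtain ⟨p, rfl⟩ := Nat.exists_eq_add_of_lt (not_le.1 hnd)
          exact not_subsingleton _
            (subsingleton_localCohomologyModule_of_hasInjectiveDimensionLT (M := M) 𝔞 (d + p)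
              (hasInjectiveDimensionLT_of_ge _ (d + 1) _ (by lia)))
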